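/- For a polynomial $f \in \mathbb{Z}[x]$ let $H(f)$ denote its height, i.e. the largest absolute value of a coefficient of $f$. For a positive integer $n$ let $B(n) = \max\{H(f) : f \in \mathbb{Z}[x],\ f(x) \mid x^n - 1 \text{ in } \mathbb{Z}[x]\}$, and let $\tau(n)$ denote the number of positive divisors of $n$. Let $\psi$ be a real-valued function defined on the positive integers such that $\psi(n) \to \infty$ as $n \to \infty$. Then $B(n) \le n^{\tau(n)\psi(n)}$ for all positive integers $n$ outside a set of asymptotic density $0$; that is, $$\lim_{N \to \infty} \frac{1}{N}\,\#\{1 \le n \le N : B(n) > n^{\tau(n)\psi(n)}\} = 0.$$ -/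

import Mathlib

open Filter Topology

/-- The set of heights of the divisors `f` of `x ^ n - 1` in `ℤ[x]`. The height of `f`, the largest
absolute value of a coefficient, is Mathlib's `Polynomial.supNorm f`. -/
def divisorHeights (n : ℕ) : Set ℝ :=
  {h | ∃ f : Polynomial ℤ, f ∣ Polynomial.X ^ n - 1 ∧ f.supNorm = h}

/-- `B(n)`: the largest height of a divisor of `x ^ n - 1` in `ℤ[x]`. For `n ≥ 1` this supremum
is a maximum, see `isGreatest_maxDivisorHeight`. -/
noncomputable def maxDivisorHeight (n : ℕ) : ℝ :=
  sSup (divisorHeights n)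

theorem isGreatest_maxDivisorHeight {n : ℕ} (hn : 1 ≤ n) :
    IsGreatest (divisorHeights n) (maxDivisorHeight n) := by
  have hne : (Polynomial.X ^ n - 1 : Polynomial ℤ) ≠ 0 := by
    simpa using Polynomial.X_pow_sub_C_ne_zero (R := ℤ) hn 1
  have hunits : Finite (Polynomial ℤ)ˣ := by
    refine Finite.of_surjective (fun u : ℤˣ => Units.map (Polynomial.C : ℤ →+* _).toMonoidHom u) ?_
    intro u
    obtain ⟨r, hr, h⟩ := Polynomial.isUnit_iff.mp u.isUnit
    exact ⟨hr.unit, Units.ext (by simpa using h)⟩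
  have : Fintype (Polynomial ℤ)ˣ := Fintype.ofFinite _
  have hfin : {f : Polynomial ℤ | f ∣ Polynomial.X ^ n - 1}.Finite :=
    @Set.toFinite _ _ (@Finite.of_fintype _
      (UniqueFactorizationMonoid.fintypeSubtypeDvd (Polynomial.X ^ n - 1 : Polynomial ℤ) hne))
  have hfin' : (divisorHeights n).Finite := hfin.image Polynomial.supNorm
  have hnon : (divisorHeights n).Nonempty := ⟨_, 1, one_dvd _, rfl⟩
  exact ⟨hnon.csSup_mem hfin', fun _ h => le_csSup hfin'.bddAbove h⟩

/-- `S` has asymptotic density `0`: `#{1 ≤ n ≤ N : n ∈ S} / N → 0` as `N → ∞`. -/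
def HasAsymptoticDensityZero (S : Set ℕ) : Prop :=
  Tendsto (fun N : ℕ => ((S ∩ Set.Icc 1 N).ncard : ℝ) / (N : ℝ)) atTop (𝓝 0)

/-!
Let `F(n)` be the product of `p ^ 2 ^ #{q ∣ n prime : q > p}` over the primes `p` dividing `n`
(`doublingProd n.primeFactors`).

*Algebra.* Write `Ψ_m = (X ^ m - 1) / Φ_m`. For a prime `p` not dividing `m`,
`Φ_{mp} (X ^ m - 1) = Φ_m(X ^ p) Ψ_m` and `Ψ_{mp} = Φ_m Ψ_m(X ^ p)`. Measuring polynomials by the sum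
of the absolute values of their coefficients, which is submultiplicative, passing from `m` to `mp`
thus squares the bound, up to a factor `mp` for the degree. Adjoining the primes of `d` in increasing
order yields the bound `2 F(d) ^ 3` for `Φ_d` (`length_cyclotomic_le`). A divisor of `X ^ n - 1` is up
to sign a product of distinct `Φ_d` with `d ∣ n`, so `B(n) ≤ (2 F(n) ^ 3) ^ τ(n)`
(`maxDivisorHeight_le`). It remains to see that `log F(n) = O(log n)` in the sense of density: that the
integers with `log F(n) > M log n` have upper density tending to `0` as `M → ∞`.

*Statistics.* We have `log F(n) = ∑ p ∣ n, 2 ^ ω_{>p}(n) log p`, where `ω_{>p}(n)` counts the primes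
`q > p` dividing `n`. The mean of this over `n ≤ N` is of order `log N log log N`, just too large, but
a moment of small order `α` is of the right size. Indeed
`(log F(n)) ^ α ≤ ∑ p ∣ n, (2 ^ α) ^ ω_{>p}(n) (log p) ^ α`, and the mean of
`(2 ^ α) ^ ω_{>p}(n)` over the multiples of `p` up to `N` is bounded by `exp ((2 ^ α - 1) T(p))`, with
`T(p)` the sum of `1 / q` over primes `p < q ≤ N`. As
`T(p) ≤ log 4 * log (log N / log p) + 2` (`sum_inv_prime_Ioc_le`), the contribution of `p` is at most a
constant times `(log N) ^ α exp (-δ T(p)) / p` with `δ = α / log 4 - (2 ^ α - 1)`. Chebyshev's constant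
`log 4` is below `1 / log 2`, so `δ > 0` for small `α`; `α = 1 / 20` works. The sum of
`exp (-δ T(p)) / p` over `p` telescopes (`sum_inv_mul_exp_neg_tail_le`), whence the moment is
`O((log N) ^ α)` (`exists_sum_log_doublingProd_rpow_le`), and Markov's inequality finishes the proof.
-/

/-! ### The length of an integer polynomial -/

open Polynomial in
/-- The length of an integer polynomial: the sum of the absolute values of its coefficients. -/
def Polynomial.length (f : ℤ[X]) : ℕ :=
  f.sum fun _ a => a.natAbs

namespace Polynomial

theorem length_zero : (0 : ℤ[X]).length = 0 := by
  simp [length]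

theorem length_monomial (i : ℕ) (a : ℤ) : (monomial i a).length = a.natAbs := by
  simp [length, sum_monomial_index]

theorem length_eq_sum_of_support_subset {f : ℤ[X]} {s : Finset ℕ} (hs : f.support ⊆ s) :
    f.length = ∑ i ∈ s, (f.coeff i).natAbs :=
  sum_eq_of_subset _ (fun _ => rfl) hs

theorem length_add_le (f g : ℤ[X]) : (f + g).length ≤ f.length + g.length := by
  rw [length_eq_sum_of_support_subset (support_add (p := f) (q := g)),
    length_eq_sum_of_support_subset (f := f) (s := f.support ∪ g.support)
      Finset.subset_union_left,
    length_eq_sum_of_support_subset (f := g) (s := f.support ∪ g.support)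
      Finset.subset_union_right, ← Finset.sum_add_distrib]
  refine Finset.sum_le_sum fun i _ => ?_
  rw [coeff_add]
  exact Int.natAbs_add_le _ _

theorem length_sum_le {ι : Type*} (s : Finset ι) (f : ι → ℤ[X]) :
    (∑ i ∈ s, f i).length ≤ ∑ i ∈ s, (f i).length :=
  Finset.le_sum_of_subadditive length length_zero.le length_add_le s f

theorem length_mul_le (f g : ℤ[X]) : (f * g).length ≤ f.length * g.length := by
  rw [mul_eq_sum_sum]
  refine (length_sum_le _ _).trans ?_
  rw [length, sum_def, Finset.sum_mul]
  refine Finset.sum_le_sum fun i _ => ?_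
  rw [sum_def]
  refine (length_sum_le _ _).trans_eq ?_
  simp only [length_monomial, Int.natAbs_mul, ← Finset.mul_sum]
  rfl

theorem length_expand_le (p : ℕ) (f : ℤ[X]) : (expand ℤ p f).length ≤ f.length := by
  rw [expand_eq_sum, sum_def]
  refine (length_sum_le _ _).trans_eq ?_
  simp only [← pow_mul, C_mul_X_pow_eq_monomial, length_monomial]
  rfl

theorem natAbs_coeff_le_length (f : ℤ[X]) (i : ℕ) : (f.coeff i).natAbs ≤ f.length := by
  by_cases hi : i ∈ f.support
  · exact Finset.single_le_sum (f := fun i => (f.coeff i).natAbs) (fun _ _ => Nat.zero_le _) hi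
  · simp [notMem_support_iff.mp hi]

theorem one_le_length {f : ℤ[X]} (hf : f ≠ 0) : 1 ≤ f.length :=
  (Int.natAbs_pos.mpr (leadingCoeff_ne_zero.mpr hf)).trans_le (natAbs_coeff_le_length f _)

theorem supNorm_le_length (f : ℤ[X]) : f.supNorm ≤ f.length := by
  obtain ⟨i, hi⟩ := f.exists_eq_supNorm
  rw [hi, Int.norm_eq_abs, ← Int.cast_abs, Int.abs_eq_natAbs]
  exact_mod_cast natAbs_coeff_le_length f i

theorem sum_range_natAbs_coeff_le_length (f : ℤ[X]) (n : ℕ) :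
    ∑ i ∈ Finset.range n, (f.coeff i).natAbs ≤ f.length := by
  rw [length_eq_sum_of_support_subset (f := f) (s := f.support ∪ Finset.range n)
      Finset.subset_union_left]
  exact Finset.sum_le_sum_of_subset Finset.subset_union_right

theorem length_le_of_natAbs_coeff_le {f : ℤ[X]} {B : ℕ} (h : ∀ i, (f.coeff i).natAbs ≤ B) :
    f.length ≤ (f.natDegree + 1) * B := by
  rw [length_eq_sum_of_support_subset (supp_subset_range (Nat.lt_succ_self _))]
  simpa using Finset.sum_le_card_nsmul (Finset.range (f.natDegree + 1)) _ B fun i _ => h i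

/-- Dividing by `X ^ m - 1` amounts to taking partial sums of coefficients along residue classes
modulo `m`, so the quotient has height at most the length of the dividend. -/
theorem natAbs_coeff_le_length_mul_X_pow_sub_one (f : ℤ[X]) {m : ℕ} (hm : 1 ≤ m) (i : ℕ) :
    (f.coeff i).natAbs ≤ (f * (X ^ m - 1)).length := by
  set g := f * (X ^ m - 1) with hg
  suffices h : (f.coeff i).natAbs ≤ ∑ j ∈ Finset.range (i + 1), (g.coeff j).natAbs from
    h.trans (sum_range_natAbs_coeff_le_length g _)
  induction i using Nat.strong_induction_on with
  | _ i ih =>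
    have hc : g.coeff i = (if m ≤ i then f.coeff (i - m) else 0) - f.coeff i := by
      rw [hg, mul_sub, mul_one, coeff_sub, coeff_mul_X_pow']
    rw [Finset.sum_range_succ]
    split_ifs at hc with hmi
    · have h1 := ih (i - m) (by omega)
      have h2 : ∑ j ∈ Finset.range (i - m + 1), (g.coeff j).natAbs
          ≤ ∑ j ∈ Finset.range i, (g.coeff j).natAbs :=
        Finset.sum_le_sum_of_subset (Finset.range_mono (by omega))
      omega
    · omega

end Polynomial

/-! ### Lengths of cyclotomic polynomials -/

/-- The product `∏ p ∈ s, p ^ 2 ^ #{q ∈ s | p < q}`: each element counts with an exponent that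
doubles for every larger element. -/
def doublingProd (s : Finset ℕ) : ℕ :=
  ∏ p ∈ s, p ^ 2 ^ (s.filter (p < ·)).card

theorem doublingProd_insert {s : Finset ℕ} {p : ℕ} (hp : ∀ q ∈ s, q < p) :
    doublingProd (insert p s) = p * doublingProd s ^ 2 := by
  have hps : p ∉ s := fun h => lt_irrefl p (hp p h)
  rw [doublingProd, Finset.prod_insert hps, doublingProd, ← Finset.prod_pow]
  congr 1
  · have : (insert p s).filter (p < ·) = ∅ := by
      rw [Finset.filter_eq_empty_iff]
      intro q hq
      rcases Finset.mem_insert.mp hq with rfl | hq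
      · exact lt_irrefl _
      · exact (hp q hq).not_gt
    simp [this]
  · refine Finset.prod_congr rfl fun q hq => ?_
    rw [Finset.filter_insert, if_pos (hp q hq), Finset.card_insert_of_notMem (by simp [hps]),
      ← pow_mul, pow_succ]

theorem doublingProd_mono {s t : Finset ℕ} (hst : s ⊆ t) (ht : ∀ p ∈ t, 1 ≤ p) :
    doublingProd s ≤ doublingProd t := by
  refine le_trans (Finset.prod_le_prod' fun p hp => ?_)
    (Finset.prod_le_prod_of_subset_of_one_le' hst fun p hp _ => Nat.one_le_pow _ _ (ht p hp))
  exact Nat.pow_le_pow_right (ht p (hst hp)) (Nat.pow_le_pow_right two_pos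
    (Finset.card_le_card (Finset.filter_subset_filter _ hst)))

open Polynomial

/-- The length bound for cyclotomic polynomials of squarefree index `m`, proved jointly for
`Φ_m` and its cofactor `Ψ_m` in `X ^ m - 1` by adjoining primes in increasing order:
`Φ_{mp} (X ^ m - 1) = Φ_m(X ^ p) Ψ_m` and `Ψ_{mp} = Φ_m Ψ_m(X ^ p)`. -/
theorem length_cyclotomic_prod_primes_le (s : Finset ℕ) (hs : ∀ p ∈ s, p.Prime) :
    ∃ g : ℤ[X], cyclotomic (∏ p ∈ s, p) ℤ * g = X ^ (∏ p ∈ s, p) - 1 ∧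
      (∏ p ∈ s, p) * (cyclotomic (∏ p ∈ s, p) ℤ).length ≤ 2 * doublingProd s ^ 3 ∧
      (∏ p ∈ s, p) * g.length ≤ 2 * doublingProd s ^ 3 := by
  induction s using Finset.induction_on_max with
  | empty =>
    refine ⟨1, by simp, ?_, ?_⟩
    · have h := length_add_le (monomial 1 1) (monomial 0 (-1))
      rw [length_monomial, length_monomial] at h
      have e : (monomial 1 1 + monomial 0 (-1) : ℤ[X]) = X - 1 := by
        rw [← C_mul_X_pow_eq_monomial, monomial_zero_left]; simp [sub_eq_add_neg]
      rw [e] at h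
      simpa [doublingProd] using h
    · have h := length_monomial 0 1
      rw [monomial_zero_left, C_1] at h
      simp [doublingProd, h]
  | insert p s hmax ih =>
    have hps : p ∉ s := fun h => lt_irrefl p (hmax p h)
    have hp : p.Prime := hs p (Finset.mem_insert_self p s)
    have hs' : ∀ q ∈ s, q.Prime := fun q hq => hs q (Finset.mem_insert_of_mem hq)
    obtain ⟨g, hg, h1, h2⟩ := ih hs'
    rw [Finset.prod_insert hps, doublingProd_insert hmax]
    set m := ∏ p ∈ s, p with hm
    set F := doublingProd s
    have hmpos : 1 ≤ m := Finset.prod_pos fun q hq => (hs' q hq).pos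
    have hpm : ¬ p ∣ m := by
      rw [hm, hp.prime.dvd_finsetProd_iff]
      rintro ⟨q, hq, hpq⟩
      exact (hmax q hq).not_ge (Nat.le_of_dvd (hs' q hq).pos hpq)
    have hexp := cyclotomic_expand_eq_cyclotomic_mul hp hpm ℤ
    have hne : cyclotomic m ℤ ≠ 0 := cyclotomic_ne_zero m ℤ
    rw [mul_comm m p] at hexp
    -- The common bound for both products of lengths.
    have hmul : (p * m) * ((p * m) * ((cyclotomic m ℤ).length * g.length))
        ≤ 2 * (p * F ^ 2) ^ 3 := by
      have h3 := Nat.mul_le_mul h1 h2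
      calc (p * m) * ((p * m) * ((cyclotomic m ℤ).length * g.length))
          = p ^ 2 * (m * (cyclotomic m ℤ).length * (m * g.length)) := by ring
        _ ≤ p ^ 2 * (2 * F ^ 3 * (2 * F ^ 3)) := Nat.mul_le_mul_left _ h3
        _ = 2 * p ^ 2 * F ^ 6 * 2 := by ring
        _ ≤ 2 * p ^ 2 * F ^ 6 * p := Nat.mul_le_mul_left _ hp.two_le
        _ = 2 * (p * F ^ 2) ^ 3 := by ring
    refine ⟨cyclotomic m ℤ * expand ℤ p g, ?_, ?_, ?_⟩
    · rw [← mul_assoc, ← hexp, ← map_mul, hg, map_sub, map_pow, expand_X, map_one, pow_mul]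
    · refine le_trans (Nat.mul_le_mul_left _ ?_) hmul
      have hquot : cyclotomic (p * m) ℤ * (X ^ m - 1) = expand ℤ p (cyclotomic m ℤ) * g := by
        rw [← hg, hexp, mul_assoc]
      have hlen : ∀ i, ((cyclotomic (p * m) ℤ).coeff i).natAbs
          ≤ (cyclotomic m ℤ).length * g.length := fun i =>
        (natAbs_coeff_le_length_mul_X_pow_sub_one _ hmpos i).trans <| by
          rw [hquot]
          exact (length_mul_le _ _).trans (Nat.mul_le_mul_right _ (length_expand_le _ _))
      refine (length_le_of_natAbs_coeff_le hlen).trans (Nat.mul_le_mul_right _ ?_)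
      rw [natDegree_cyclotomic]
      exact Nat.totient_lt _ (hp.two_le.trans (Nat.le_mul_of_pos_right p hmpos))
    · refine le_trans (Nat.mul_le_mul_left _ ?_) hmul
      calc (cyclotomic m ℤ * expand ℤ p g).length
          ≤ (cyclotomic m ℤ).length * g.length :=
            (length_mul_le _ _).trans (Nat.mul_le_mul_left _ (length_expand_le _ _))
        _ ≤ (p * m) * ((cyclotomic m ℤ).length * g.length) :=
            Nat.le_mul_of_pos_left _ (Nat.mul_pos hp.pos hmpos)

/-- Primes already dividing the index only substitute a power of `X` in the cyclotomic
polynomial. -/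
theorem length_cyclotomic_mul_le (r t : ℕ) (ht : t ≠ 0) (h : ∀ p, p.Prime → p ∣ t → p ∣ r) :
    (cyclotomic (r * t) ℤ).length ≤ (cyclotomic r ℤ).length := by
  induction t using induction_on_primes with
  | zero => exact absurd rfl ht
  | one => simp
  | prime_mul p a hp ih =>
    have ha : a ≠ 0 := right_ne_zero_of_mul ht
    have hpr : p ∣ r * a := (h p hp (dvd_mul_right p a)).mul_right a
    rw [mul_comm p a, ← mul_assoc, ← cyclotomic_expand_eq_cyclotomic hp hpr]
    exact (length_expand_le _ _).trans
      (ih ha fun q hq hqa => h q hq (hqa.mul_left p))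

theorem length_cyclotomic_le {n : ℕ} (hn : n ≠ 0) :
    (cyclotomic n ℤ).length ≤ 2 * doublingProd n.primeFactors ^ 3 := by
  obtain ⟨t, ht⟩ := Nat.prod_primeFactors_dvd n
  have ht0 : t ≠ 0 := by rintro rfl; simp at ht; exact hn ht
  have hpos : 0 < ∏ p ∈ n.primeFactors, p :=
    Finset.prod_pos fun p hp => Nat.pos_of_mem_primeFactors hp
  have hle : (cyclotomic n ℤ).length ≤ (cyclotomic (∏ p ∈ n.primeFactors, p) ℤ).length := by
    conv_lhs => rw [ht]
    refine length_cyclotomic_mul_le _ _ ht0 fun p hp hpt => Finset.dvd_prod_of_mem _ ?_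
    exact Nat.mem_primeFactors.mpr ⟨hp, ht ▸ hpt.mul_left _, hn⟩
  obtain ⟨g, -, h, -⟩ := length_cyclotomic_prod_primes_le n.primeFactors
    fun p hp => Nat.prime_of_mem_primeFactors hp
  exact hle.trans ((Nat.le_mul_of_pos_left _ hpos).trans h)

/-! ### Heights of divisors of `X ^ n - 1` -/

theorem length_le_prod_of_dvd_prod {ι : Type*} (s : Finset ι) (P : ι → ℤ[X])
    (hP : ∀ i ∈ s, Prime (P i)) {f : ℤ[X]} (hf : f ∣ ∏ i ∈ s, P i) :
    f.length ≤ ∏ i ∈ s, (P i).length := by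
  classical
  induction s using Finset.induction_on generalizing f with
  | empty =>
    rw [Finset.prod_empty] at hf ⊢
    obtain ⟨r, hr, rfl⟩ := Polynomial.isUnit_iff.mp (isUnit_of_dvd_one hf)
    rw [← monomial_zero_left, length_monomial, Int.isUnit_iff_natAbs_eq.mp hr]
  | insert a s ha ih =>
    have hPs : ∀ i ∈ s, Prime (P i) := fun i hi => hP i (Finset.mem_insert_of_mem hi)
    have hPa : Prime (P a) := hP a (Finset.mem_insert_self a s)
    rw [Finset.prod_insert ha] at hf ⊢
    obtain ⟨h, hh⟩ := hf
    rcases hPa.dvd_or_dvd (hh ▸ dvd_mul_right (P a) _) with ⟨g, rfl⟩ | ⟨g, rfl⟩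
    · refine (length_mul_le _ _).trans (Nat.mul_le_mul_left _ (ih hPs ⟨h, ?_⟩))
      rw [mul_assoc] at hh
      exact mul_left_cancel₀ hPa.ne_zero hh
    · refine (ih hPs ⟨g, ?_⟩).trans (Nat.le_mul_of_pos_left _ (one_le_length hPa.ne_zero))
      rw [mul_left_comm] at hh
      exact mul_left_cancel₀ hPa.ne_zero hh

/-- A divisor of `X ^ n - 1` is, up to sign, a product of distinct `Φ_d` with `d ∣ n`, each of
which obeys the bound for `n` itself because `doublingProd` is monotone. -/
theorem maxDivisorHeight_le {n : ℕ} (hn : 1 ≤ n) :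
    maxDivisorHeight n ≤ (2 * (doublingProd n.primeFactors : ℝ) ^ 3) ^ n.divisors.card := by
  obtain ⟨f, hf, hfn⟩ := (isGreatest_maxDivisorHeight hn).1
  rw [← hfn, ← prod_cyclotomic_eq_X_pow_sub_one hn ℤ] at *
  have hprime : ∀ d ∈ n.divisors, Prime (cyclotomic d ℤ) := fun d hd =>
    (cyclotomic.irreducible (Nat.pos_of_mem_divisors hd)).prime
  have hbound : f.length ≤ (2 * doublingProd n.primeFactors ^ 3) ^ n.divisors.card := by
    refine (length_le_prod_of_dvd_prod _ _ hprime hf).trans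
      (Finset.prod_le_pow_card _ _ _ fun d hd => ?_)
    refine (length_cyclotomic_le (Nat.pos_of_mem_divisors hd).ne').trans ?_
    gcongr
    exact doublingProd_mono (Nat.primeFactors_mono (Nat.dvd_of_mem_divisors hd) (by omega))
      fun p hp => Nat.pos_of_mem_primeFactors hp
  exact (supNorm_le_length f).trans (by exact_mod_cast hbound)

/-! ### Sums over primes -/

/-- Partial summation against `θ(x) ≤ x log 4`, carried out as an induction on the endpoint. -/
theorem sum_inv_prime_Ioc_le {y n : ℕ} (hy : 2 ≤ y) (hyn : y ≤ n) :
    ∑ q ∈ (Finset.Ioc y n).filter Nat.Prime, (1 / q : ℝ)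
      ≤ Real.log 4 * (Real.log (Real.log n) - Real.log (Real.log y)) + 2 := by
  have hlog4 : Real.log 4 = 2 * Real.log 2 := by
    rw [show (4 : ℝ) = 2 ^ 2 by norm_num, Real.log_pow]; norm_num
  have hlog4pos : 0 ≤ Real.log 4 := Real.log_nonneg (by norm_num)
  have hlogpos : ∀ k : ℕ, y ≤ k → 0 < Real.log k := fun k hk =>
    Real.log_pos (by exact_mod_cast (show 1 < k by omega))
  have htheta : ∀ k : ℕ, Chebyshev.theta k ≤ Real.log 4 * k := fun k =>
    Chebyshev.theta_le_log4_mul_x (Nat.cast_nonneg k)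
  have hy0 : (0 : ℝ) < y := by exact_mod_cast (show 0 < y by omega)
  suffices h : ∑ q ∈ (Finset.Ioc y n).filter Nat.Prime, (1 / q : ℝ)
      + (Real.log 4 * n - Chebyshev.theta n) / (n * Real.log n)
      ≤ Real.log 4 * (Real.log (Real.log n) - Real.log (Real.log y)) + 2 by
    have h0 : 0 ≤ (Real.log 4 * n - Chebyshev.theta n) / (n * Real.log n) :=
      div_nonneg (sub_nonneg.mpr (htheta n))
        (mul_nonneg (Nat.cast_nonneg n) (hlogpos n hyn).le)
    linarith
  induction n, hyn using Nat.le_induction with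
  | base =>
    have hly := hlogpos y le_rfl
    have hly2 : Real.log 2 ≤ Real.log y :=
      Real.log_le_log two_pos (by exact_mod_cast hy)
    have h1 : (Real.log 4 * y - Chebyshev.theta y) / (y * Real.log y) ≤ 2 := by
      rw [div_le_iff₀ (by positivity)]
      have := Chebyshev.theta_nonneg y
      nlinarith
    simpa using h1
  | succ k hk ih =>
    have hlk := hlogpos k hk
    have hlk1 := hlogpos (k + 1) (by omega)
    have hk0 : (0 : ℝ) < k := by exact_mod_cast (show 0 < k by omega)
    set a : ℝ := if (k + 1).Prime then Real.log (k + 1 : ℕ) else 0 with ha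
    have hsum : ∑ q ∈ (Finset.Ioc y (k + 1)).filter Nat.Prime, (1 / q : ℝ)
        = ∑ q ∈ (Finset.Ioc y k).filter Nat.Prime, (1 / q : ℝ)
          + a / ((k + 1 : ℕ) * Real.log (k + 1 : ℕ)) := by
      rw [Finset.sum_filter, Finset.sum_filter,
        Finset.sum_Ioc_succ_top (by omega)]
      congr 1
      rw [ha]
      split_ifs
      · field_simp
      · simp
    have hth : Chebyshev.theta (k + 1 : ℕ) = Chebyshev.theta k + a := by
      simp only [Chebyshev.theta, Nat.floor_natCast, Finset.sum_filter]
      rw [Finset.sum_Ioc_succ_top (by omega)]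
    -- `log (log (k + 1)) - log (log k)` dominates the reciprocal of `(k + 1) * log (k + 1)`.
    have hll : 1 / ((k + 1 : ℕ) * Real.log (k + 1 : ℕ))
        ≤ Real.log (Real.log (k + 1 : ℕ)) - Real.log (Real.log k) := by
      have h1 := Real.one_sub_inv_le_log_of_pos (div_pos hlk1 hlk)
      have h2 := Real.one_sub_inv_le_log_of_pos
        (show (0 : ℝ) < (k + 1 : ℕ) / k by positivity)
      rw [Real.log_div hlk1.ne' hlk.ne'] at h1
      rw [Real.log_div (by positivity) hk0.ne'] at h2
      refine le_trans ?_ h1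
      have h3 : (1 : ℝ) / (k + 1 : ℕ) ≤ Real.log (k + 1 : ℕ) - Real.log k := by
        refine le_trans (le_of_eq ?_) h2
        push_cast
        field_simp
        ring
      have h4 : 1 - (Real.log (k + 1 : ℕ) / Real.log k)⁻¹
          = (Real.log (k + 1 : ℕ) - Real.log k) / Real.log (k + 1 : ℕ) := by
        field_simp
      rw [h4, ← div_div]
      gcongr
    have hw : (Real.log 4 * k - Chebyshev.theta k) / ((k + 1 : ℕ) * Real.log (k + 1 : ℕ))
        ≤ (Real.log 4 * k - Chebyshev.theta k) / (k * Real.log k) := by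
      refine div_le_div_of_nonneg_left (sub_nonneg.mpr (htheta k)) (by positivity) ?_
      have : (k : ℝ) ≤ (k + 1 : ℕ) := by exact_mod_cast Nat.le_succ k
      gcongr
    have hsplit : a / ((k + 1 : ℕ) * Real.log (k + 1 : ℕ))
        + (Real.log 4 * (k + 1 : ℕ) - Chebyshev.theta (k + 1 : ℕ))
          / ((k + 1 : ℕ) * Real.log (k + 1 : ℕ))
        = (Real.log 4 * k - Chebyshev.theta k) / ((k + 1 : ℕ) * Real.log (k + 1 : ℕ))
          + Real.log 4 * (1 / ((k + 1 : ℕ) * Real.log (k + 1 : ℕ))) := by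
      rw [hth, ← add_div, mul_one_div, ← add_div]
      congr 1
      push_cast
      ring
    have := mul_le_mul_of_nonneg_left hll hlog4pos
    rw [hsum, add_assoc, hsplit]
    linarith

/-- A discrete form of `∫ exp (-δ t) dt ≤ 1 / δ`: the summands telescope up to a constant. -/
theorem sum_inv_mul_exp_neg_tail_le {δ : ℝ} (hδ : 0 < δ) (hδ1 : δ ≤ 1) (s : Finset ℕ)
    (hs : ∀ p ∈ s, 1 ≤ p) :
    ∑ p ∈ s, (1 / p : ℝ) * Real.exp (-δ * ∑ q ∈ s.filter (p < ·), (1 / q : ℝ)) ≤ 2 / δ := by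
  suffices h : ∑ p ∈ s, (1 / p : ℝ) * Real.exp (-δ * ∑ q ∈ s.filter (p < ·), (1 / q : ℝ))
      ≤ 2 / δ * (1 - Real.exp (-δ * ∑ q ∈ s, (1 / q : ℝ))) by
    refine h.trans (mul_le_of_le_one_right (by positivity) ?_)
    linarith [Real.exp_pos (-δ * ∑ q ∈ s, (1 / q : ℝ))]
  induction s using Finset.induction_on_min with
  | empty => simp
  | insert a s hmin ih =>
    have has : a ∉ s := fun h => lt_irrefl a (hmin a h)
    have ha : (1 : ℝ) ≤ a := by exact_mod_cast hs a (Finset.mem_insert_self a s)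
    have hfa : (insert a s).filter (a < ·) = s := by
      rw [Finset.filter_insert, if_neg (lt_irrefl a)]
      exact Finset.filter_true_of_mem hmin
    have hfs : ∀ p ∈ s, (insert a s).filter (p < ·) = s.filter (p < ·) := fun p hp => by
      rw [Finset.filter_insert, if_neg (hmin p hp).not_gt]
    have hcongr : ∑ p ∈ s, (1 / p : ℝ)
          * Real.exp (-δ * ∑ q ∈ (insert a s).filter (p < ·), (1 / q : ℝ))
        = ∑ p ∈ s, (1 / p : ℝ) * Real.exp (-δ * ∑ q ∈ s.filter (p < ·), (1 / q : ℝ)) :=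
      Finset.sum_congr rfl fun p hp => by rw [hfs p hp]
    rw [Finset.sum_insert has, Finset.sum_insert has, hfa, hcongr]
    have ih' := ih fun p hp => hs p (Finset.mem_insert_of_mem hp)
    set T := ∑ q ∈ s, (1 / q : ℝ)
    set u : ℝ := δ * (1 / a) with hu
    have hu0 : 0 < u := by positivity
    have hu1 : u ≤ 1 := mul_le_one₀ hδ1 (by positivity) (by rw [div_le_one (by linarith)]; exact ha)
    have hexp : Real.exp (-u) ≤ 1 - u / 2 := by
      rw [Real.exp_neg]
      have h1 := Real.add_one_le_exp u
      calc (Real.exp u)⁻¹ ≤ (u + 1)⁻¹ := inv_anti₀ (by linarith) h1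
        _ ≤ 1 - u / 2 := by
          rw [inv_le_iff_one_le_mul₀ (by linarith)]
          nlinarith
    have hsplit : Real.exp (-δ * (1 / a + T)) = Real.exp (-u) * Real.exp (-δ * T) := by
      rw [← Real.exp_add, hu]; ring_nf
    have hstep : (1 / a : ℝ) * Real.exp (-δ * T)
        ≤ 2 / δ * (Real.exp (-δ * T) - Real.exp (-u) * Real.exp (-δ * T)) := by
      have h2 : (1 / a : ℝ) = 2 / δ * (u / 2) := by rw [hu]; field_simp
      rw [h2, mul_assoc]
      refine mul_le_mul_of_nonneg_left ?_ (by positivity)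
      nlinarith [Real.exp_pos (-δ * T)]
    rw [hsplit]
    linarith

/-! ### A fractional moment of `log (doublingProd n.primeFactors)` -/

/-- The mean of `(1 + c) ^ #{q ∈ Q | q ∣ n}` over multiples `n` of `d`, for a set `Q` of primes
not dividing `d`, is at most its Euler product. -/
theorem sum_one_add_pow_card_dvd_le {c : ℝ} (hc : 0 ≤ c) (N : ℕ) (Q : Finset ℕ)
    (hQ : ∀ q ∈ Q, q.Prime) (d : ℕ) (hd : ∀ q ∈ Q, ¬ q ∣ d) :
    ∑ n ∈ (Finset.Ioc 0 N).filter (d ∣ ·), (1 + c) ^ (Q.filter (· ∣ n)).card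
      ≤ N / d * ∏ q ∈ Q, (1 + c / q) := by
  induction Q using Finset.induction_on generalizing d with
  | empty =>
    simp only [Finset.filter_empty, Finset.card_empty, pow_zero, Finset.sum_const,
      Finset.prod_empty, mul_one, nsmul_eq_mul, Nat.Ioc_filter_dvd_card_eq_div]
    exact Nat.cast_div_le
  | insert q Q hq ih =>
    have hQ' : ∀ r ∈ Q, r.Prime := fun r hr => hQ r (Finset.mem_insert_of_mem hr)
    have hqp : q.Prime := hQ q (Finset.mem_insert_self q Q)
    have hqd : ¬ q ∣ d := hd q (Finset.mem_insert_self q Q)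
    have h1 := ih hQ' d fun r hr => hd r (Finset.mem_insert_of_mem hr)
    have h2 := ih hQ' (d * q) fun r hr hrd => by
      rcases (hQ' r hr).dvd_mul.mp hrd with h | h
      · exact hd r (Finset.mem_insert_of_mem hr) h
      · exact hq ((Nat.prime_dvd_prime_iff_eq (hQ' r hr) hqp).mp h ▸ hr)
    have hterm : ∀ n, (1 + c) ^ ((insert q Q).filter (· ∣ n)).card
        = (1 + c) ^ (Q.filter (· ∣ n)).card
          + if q ∣ n then c * (1 + c) ^ (Q.filter (· ∣ n)).card else 0 := by
      intro n
      rw [Finset.filter_insert]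
      split_ifs
      · rw [Finset.card_insert_of_notMem (by simp [hq]), pow_succ]
        ring
      · simp
    have hfilter : ((Finset.Ioc 0 N).filter (d ∣ ·)).filter (q ∣ ·)
        = (Finset.Ioc 0 N).filter (d * q ∣ ·) := by
      rw [Finset.filter_filter]
      refine Finset.filter_congr fun n _ => ?_
      have hcop : Nat.Coprime d q := ((Nat.Prime.coprime_iff_not_dvd hqp).mpr hqd).symm
      exact ⟨fun h => hcop.mul_dvd_of_dvd_of_dvd h.1 h.2,
        fun h => ⟨dvd_of_mul_right_dvd h, dvd_of_mul_left_dvd h⟩⟩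
    simp only [hterm]
    rw [Finset.sum_add_distrib, ← Finset.sum_filter, hfilter, ← Finset.mul_sum,
      Finset.prod_insert hq]
    refine (add_le_add h1 (mul_le_mul_of_nonneg_left h2 hc)).trans_eq ?_
    push_cast
    rw [← div_div]
    ring

theorem sum_one_add_pow_card_large_primeFactors_le {c : ℝ} (hc : 0 ≤ c) (N : ℕ) {p : ℕ}
    (hp : p.Prime) :
    ∑ n ∈ (Finset.Ioc 0 N).filter (p ∣ ·), (1 + c) ^ (n.primeFactors.filter (p < ·)).card
      ≤ N / p * Real.exp (c * ∑ q ∈ (Finset.Ioc p N).filter Nat.Prime, (1 / q : ℝ)) := by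
  set Q := (Finset.Ioc p N).filter Nat.Prime with hQ
  have hcard : ∀ n ∈ (Finset.Ioc 0 N).filter (p ∣ ·),
      (1 + c) ^ (n.primeFactors.filter (p < ·)).card = (1 + c) ^ (Q.filter (· ∣ n)).card := by
    intro n hn
    congr 2
    obtain ⟨hn0, hnN⟩ := Finset.mem_Ioc.mp (Finset.mem_filter.mp hn).1
    ext q
    simp only [hQ, Finset.mem_filter, Nat.mem_primeFactors, Finset.mem_Ioc]
    constructor
    · rintro ⟨⟨h1, h2, -⟩, h3⟩
      exact ⟨⟨⟨h3, (Nat.le_of_dvd hn0 h2).trans hnN⟩, h1⟩, h2⟩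
    · rintro ⟨⟨⟨h3, -⟩, h1⟩, h2⟩
      exact ⟨⟨h1, h2, hn0.ne'⟩, h3⟩
  rw [Finset.sum_congr rfl hcard]
  refine (sum_one_add_pow_card_dvd_le hc N Q (fun q hq => (Finset.mem_filter.mp hq).2) p
    fun q hq hqp => ?_).trans ?_
  · have h1 := (Finset.mem_Ioc.mp (Finset.mem_filter.mp hq).1).1
    exact h1.not_ge (Nat.le_of_dvd hp.pos hqp)
  · refine mul_le_mul_of_nonneg_left ?_ (by positivity)
    rw [Finset.mul_sum, Real.exp_sum]
    refine Finset.prod_le_prod (fun q _ => by positivity) fun q _ => ?_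
    rw [mul_one_div, add_comm]
    exact Real.add_one_le_exp _

theorem log_doublingProd {s : Finset ℕ} (hs : ∀ p ∈ s, p ≠ 0) :
    Real.log (doublingProd s) = ∑ p ∈ s, 2 ^ (s.filter (p < ·)).card * Real.log p := by
  rw [doublingProd, Nat.cast_prod, Real.log_prod fun p hp => by
    exact_mod_cast pow_ne_zero _ (hs p hp)]
  refine Finset.sum_congr rfl fun p _ => ?_
  rw [Nat.cast_pow, Real.log_pow]
  push_cast
  rfl

/-- For the exponent `α = 1 / 20` the moment argument gains: `2 ^ α - 1 < α / log 4`. -/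
theorem two_rpow_sub_one_lt : (2 : ℝ) ^ (1 / 20 : ℝ) - 1 < 1 / 20 / Real.log 4 := by
  have h1 : (2 : ℝ) ^ (1 / 20 : ℝ) ≤ 1.0353 := by
    rw [one_div, Real.rpow_inv_le_iff_of_pos (by norm_num) (by norm_num) (by norm_num)]
    norm_num
  have h2 : Real.log 4 = 2 * Real.log 2 := by
    rw [show (4 : ℝ) = 2 ^ 2 by norm_num, Real.log_pow]; norm_num
  have h3 : (0.0353 : ℝ) < 1 / 20 / Real.log 4 := by
    rw [lt_div_iff₀ (Real.log_pos (by norm_num)), h2]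
    linarith [Real.log_two_lt_d9]
  linarith

theorem sum_rpow_le_sum_rpow {ι : Type*} (s : Finset ι) (x : ι → ℝ) (hx : ∀ i ∈ s, 0 ≤ x i)
    {a : ℝ} (ha : 0 < a) (ha1 : a ≤ 1) : (∑ i ∈ s, x i) ^ a ≤ ∑ i ∈ s, x i ^ a := by
  refine Finset.le_sum_of_subadditive_on_pred (fun y : ℝ => y ^ a) (fun y => 0 ≤ y)
    (by simp [Real.zero_rpow ha.ne']) (fun y z hy hz => Real.rpow_add_le_add_rpow hy hz ha.le ha1)
    (fun y z => add_nonneg) x hx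

/-- The moment of order `1 / 20` of `log (doublingProd n.primeFactors)` over `n ≤ N` has the order
of magnitude of `(log N) ^ (1 / 20)`. The first moment would lose a factor `log (log N)`. -/
theorem exists_sum_log_doublingProd_rpow_le :
    ∃ C : ℝ, 0 < C ∧ ∀ N : ℕ, 2 ≤ N →
      ∑ n ∈ Finset.Ioc 0 N, Real.log (doublingProd n.primeFactors) ^ (1 / 20 : ℝ)
        ≤ C * N * Real.log N ^ (1 / 20 : ℝ) := by
  set α : ℝ := 1 / 20 with hα
  have hα0 : 0 < α := by norm_num [hα]
  have hα1 : α ≤ 1 := by norm_num [hα]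
  set c : ℝ := 2 ^ α - 1 with hc
  have hc0 : 0 ≤ c := sub_nonneg.mpr (Real.one_le_rpow one_le_two hα0.le)
  have hlog4 : 1 ≤ Real.log 4 := by
    have h : Real.log 4 = 2 * Real.log 2 := by
      rw [show (4 : ℝ) = 2 ^ 2 by norm_num, Real.log_pow]; norm_num
    linarith [Real.log_two_gt_d9]
  set δ : ℝ := α / Real.log 4 - c with hδ
  have hδ0 : 0 < δ := sub_pos.mpr two_rpow_sub_one_lt
  have hδ1 : δ ≤ 1 := by
    have : α / Real.log 4 ≤ 1 := (div_le_one (by linarith)).mpr (hα1.trans hlog4)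
    linarith
  refine ⟨Real.exp (2 * α / Real.log 4) * (2 / δ), by positivity, fun N hN => ?_⟩
  have hlogN : 0 < Real.log N := Real.log_pos (by exact_mod_cast hN)
  set P := (Finset.Ioc 0 N).filter Nat.Prime with hP
  have hfilter : ∀ p : ℕ, P.filter (p < ·) = (Finset.Ioc p N).filter Nat.Prime := fun p => by
    ext q
    simp only [hP, Finset.mem_filter, Finset.mem_Ioc]
    constructor
    · rintro ⟨⟨⟨-, h1⟩, h2⟩, h3⟩
      exact ⟨⟨h3, h1⟩, h2⟩
    · rintro ⟨⟨h3, h1⟩, h2⟩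
      exact ⟨⟨⟨h2.pos, h1⟩, h2⟩, h3⟩
  -- The upper bound for `T`, the sum of the reciprocals of the primes in `(p, N]`, trades the factor
  -- `(log p / log N) ^ α` for `exp (-α T / log 4)`, which outweighs the `exp (c T)` present.
  have hterm : ∀ p ∈ P, Real.log p ^ α * (N / p * Real.exp (c * ∑ q ∈ P.filter (p < ·),
        (1 / q : ℝ)))
      ≤ N * Real.log N ^ α * Real.exp (2 * α / Real.log 4) *
        ((1 / p : ℝ) * Real.exp (-δ * ∑ q ∈ P.filter (p < ·), (1 / q : ℝ))) := by
    intro p hp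
    obtain ⟨hpI, hpp⟩ := Finset.mem_filter.mp hp
    have hpN := (Finset.mem_Ioc.mp hpI).2
    have hlogp : 0 < Real.log p := Real.log_pos (by exact_mod_cast hpp.one_lt)
    have hT := sum_inv_prime_Ioc_le hpp.two_le hpN
    rw [hfilter]
    set T := ∑ q ∈ (Finset.Ioc p N).filter Nat.Prime, (1 / q : ℝ)
    have hkey : Real.log p ^ α
        ≤ Real.log N ^ α * Real.exp (2 * α / Real.log 4 - α / Real.log 4 * T) := by
      rw [Real.rpow_def_of_pos hlogp, Real.rpow_def_of_pos hlogN, ← Real.exp_add]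
      refine Real.exp_le_exp.mpr ?_
      have h1 := mul_le_mul_of_nonneg_left hT (show 0 ≤ α / Real.log 4 by positivity)
      have h2 : α / Real.log 4 * (Real.log 4 * (Real.log (Real.log N) - Real.log (Real.log p)) + 2)
          = α * (Real.log (Real.log N) - Real.log (Real.log p)) + 2 * α / Real.log 4 := by
        field_simp
      rw [h2] at h1
      linarith
    calc Real.log p ^ α * (N / p * Real.exp (c * T))
        ≤ Real.log N ^ α * Real.exp (2 * α / Real.log 4 - α / Real.log 4 * T)
            * (N / p * Real.exp (c * T)) := by gcongr
      _ = N * Real.log N ^ α * (1 / p) *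
            (Real.exp (2 * α / Real.log 4 - α / Real.log 4 * T) * Real.exp (c * T)) := by ring
      _ = N * Real.log N ^ α * (1 / p) * (Real.exp (2 * α / Real.log 4) * Real.exp (-δ * T)) := by
          rw [← Real.exp_add, ← Real.exp_add, hδ]
          congr 2
          ring
      _ = _ := by ring
  calc ∑ n ∈ Finset.Ioc 0 N, Real.log (doublingProd n.primeFactors) ^ α
      ≤ ∑ n ∈ Finset.Ioc 0 N, ∑ p ∈ n.primeFactors,
          Real.log p ^ α * (1 + c) ^ (n.primeFactors.filter (p < ·)).card := by
        refine Finset.sum_le_sum fun n _ => ?_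
        rw [log_doublingProd fun p hp => (Nat.pos_of_mem_primeFactors hp).ne']
        refine (sum_rpow_le_sum_rpow _ _ (fun p _ => by positivity) hα0 hα1).trans_eq
          (Finset.sum_congr rfl fun p _ => ?_)
        rw [Real.mul_rpow (by positivity) (by positivity), ← Real.rpow_natCast 2,
          ← Real.rpow_mul zero_le_two, mul_comm (Nat.cast _) α, Real.rpow_mul zero_le_two,
          Real.rpow_natCast, mul_comm, hc, add_sub_cancel]
    _ = ∑ p ∈ P, ∑ n ∈ (Finset.Ioc 0 N).filter (p ∣ ·),
          Real.log p ^ α * (1 + c) ^ (n.primeFactors.filter (p < ·)).card := by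
        refine Finset.sum_comm' fun n p => ?_
        simp only [hP, Finset.mem_filter, Finset.mem_Ioc, Nat.mem_primeFactors]
        constructor
        · rintro ⟨⟨h1, h2⟩, h3, h4, -⟩
          exact ⟨⟨⟨h1, h2⟩, h4⟩, ⟨h3.pos, (Nat.le_of_dvd h1 h4).trans h2⟩, h3⟩
        · rintro ⟨⟨⟨h1, h2⟩, h4⟩, -, h3⟩
          exact ⟨⟨h1, h2⟩, h3, h4, h1.ne'⟩
    _ ≤ ∑ p ∈ P, N * Real.log N ^ α * Real.exp (2 * α / Real.log 4) *
        ((1 / p : ℝ) * Real.exp (-δ * ∑ q ∈ P.filter (p < ·), (1 / q : ℝ))) := by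
        refine Finset.sum_le_sum fun p hp => le_trans ?_ (hterm p hp)
        rw [← Finset.mul_sum, hfilter]
        exact mul_le_mul_of_nonneg_left (sum_one_add_pow_card_large_primeFactors_le hc0 N
          (Finset.mem_filter.mp hp).2) (by positivity)
    _ ≤ N * Real.log N ^ α * Real.exp (2 * α / Real.log 4) * (2 / δ) := by
        rw [← Finset.mul_sum]
        exact mul_le_mul_of_nonneg_left (sum_inv_mul_exp_neg_tail_le hδ0 hδ1 P fun p hp =>
          (Finset.mem_filter.mp hp).2.pos) (by positivity)
    _ = _ := by ring

/-! ### Density of the exceptional set -/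

theorem lt_log_doublingProd_of_lt_maxDivisorHeight {n : ℕ} (hn : 2 ≤ n) {M t : ℝ}
    (ht : 4 * M ≤ t) (h : (n : ℝ) ^ ((n.divisors.card : ℝ) * t) < maxDivisorHeight n) :
    M * Real.log n < Real.log (doublingProd n.primeFactors) := by
  have hn0 : (0 : ℝ) < n := by exact_mod_cast (show 0 < n by omega)
  have hlogn : 0 < Real.log n := Real.log_pos (by exact_mod_cast hn)
  have hF : 2 ≤ doublingProd n.primeFactors := by
    obtain ⟨p, hp⟩ := Nat.nonempty_primeFactors.mpr hn
    have h1 := doublingProd_mono (Finset.singleton_subset_iff.mpr hp)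
      fun q hq => Nat.pos_of_mem_primeFactors hq
    have h2 := (Nat.prime_of_mem_primeFactors hp).two_le
    have h3 : doublingProd {p} = p := by simp [doublingProd, Finset.filter_singleton]
    omega
  set F := doublingProd n.primeFactors
  have hF0 : (0 : ℝ) < F := by exact_mod_cast (show 0 < F by omega)
  have hlogF : Real.log 2 ≤ Real.log F := Real.log_le_log two_pos (by exact_mod_cast hF)
  have h1 : (n : ℝ) ^ t < 2 * (F : ℝ) ^ 3 := by
    refine lt_of_pow_lt_pow_left₀ n.divisors.card (by positivity) ?_
    rw [← Real.rpow_natCast, ← Real.rpow_mul hn0.le, mul_comm t]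
    exact h.trans_le (maxDivisorHeight_le (by omega))
  have h2 := Real.log_lt_log (by positivity) h1
  rw [Real.log_rpow hn0, Real.log_mul two_ne_zero (by positivity), Real.log_pow] at h2
  push_cast at h2
  nlinarith

theorem theorem1p2 (ψ : ℕ → ℝ) (hψ : Tendsto ψ atTop atTop) :
    HasAsymptoticDensityZero
      {n : ℕ | 1 ≤ n ∧
        ¬ (maxDivisorHeight n ≤ (n : ℝ) ^ ((n.divisors.card : ℝ) * ψ n))} := by
  set S := {n : ℕ | 1 ≤ n ∧
    ¬ (maxDivisorHeight n ≤ (n : ℝ) ^ ((n.divisors.card : ℝ) * ψ n))} with hS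
  obtain ⟨C, hC0, hC⟩ := exists_sum_log_doublingProd_rpow_le
  refine Metric.tendsto_nhds.mpr fun ε hε => ?_
  -- `M` is chosen so that Markov's inequality leaves at most `ε / 2 * N` integers.
  set M : ℝ := (2 * C / ε) ^ 20 with hM
  have hM0 : 0 < M := by positivity
  have hMα : M ^ (1 / 20 : ℝ) = 2 * C / ε := by
    rw [hM, one_div]
    exact_mod_cast Real.pow_rpow_inv_natCast (n := 20) (show 0 ≤ 2 * C / ε by positivity)
      (by norm_num)
  obtain ⟨n₀, hn₀⟩ := eventually_atTop.mp (hψ.eventually_ge_atTop (4 * (2 * M)))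
  have hsqrt : Tendsto (fun N : ℕ => √(N : ℝ)) atTop atTop :=
    Real.tendsto_sqrt_atTop.comp tendsto_natCast_atTop_atTop
  filter_upwards [hsqrt.eventually_gt_atTop (2 * (n₀ + 4) / ε), hsqrt.eventually_ge_atTop 1,
    eventually_ge_atTop 2] with N hN1 hN2 hN3
  have hN0 : (0 : ℝ) < N := by exact_mod_cast (show 0 < N by omega)
  have hlogN : 0 < Real.log N := Real.log_pos (by exact_mod_cast hN3)
  set E := (Finset.Ioc 0 N).filter
    fun n => M * Real.log N < Real.log (doublingProd n.primeFactors) with hE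
  have hsub : S ∩ Set.Icc 1 N
      ⊆ ((Finset.range (n₀ + 2) ∪ Finset.range (N.sqrt + 1) ∪ E : Finset ℕ) : Set ℕ) := by
    rintro n ⟨⟨-, hn⟩, hn1, hnN⟩
    rw [Finset.mem_coe, Finset.mem_union, Finset.mem_union, Finset.mem_range, Finset.mem_range,
      or_iff_not_imp_left, not_or, not_lt, not_lt]
    rintro ⟨h1, h2⟩
    refine Finset.mem_filter.mpr ⟨Finset.mem_Ioc.mpr ⟨hn1, hnN⟩, ?_⟩
    refine lt_of_le_of_lt ?_ (lt_log_doublingProd_of_lt_maxDivisorHeight (by omega)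
      (hn₀ n (by omega)) (not_le.mp hn))
    -- Beyond `√N`, `log n` is at least half of `log N`.
    have h3 : (N : ℝ) ≤ (n : ℝ) ^ 2 := by
      exact_mod_cast (Nat.sqrt_lt'.mp (Nat.lt_of_succ_le h2)).le
    have h4 := Real.log_le_log hN0 h3
    rw [Real.log_pow] at h4
    push_cast at h4
    nlinarith
  have hEcard : (E.card : ℝ) ≤ ε / 2 * N := by
    have h1 : E.card • (M * Real.log N) ^ (1 / 20 : ℝ)
        ≤ ∑ n ∈ E, Real.log (doublingProd n.primeFactors) ^ (1 / 20 : ℝ) :=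
      Finset.card_nsmul_le_sum _ _ _ fun n hn =>
        Real.rpow_le_rpow (by positivity) (Finset.mem_filter.mp hn).2.le (by norm_num)
    have h2 : ∑ n ∈ E, Real.log (doublingProd n.primeFactors) ^ (1 / 20 : ℝ)
        ≤ ∑ n ∈ Finset.Ioc 0 N, Real.log (doublingProd n.primeFactors) ^ (1 / 20 : ℝ) :=
      Finset.sum_le_sum_of_subset_of_nonneg (Finset.filter_subset _ _) fun n _ _ =>
        Real.rpow_nonneg (Real.log_natCast_nonneg _) _
    have h3 := h1.trans (h2.trans (hC N hN3))
    rw [nsmul_eq_mul, Real.mul_rpow hM0.le hlogN.le, hMα, ← mul_assoc] at h3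
    have h4 := le_of_mul_le_mul_right h3 (Real.rpow_pos_of_pos hlogN _)
    rw [← mul_div_assoc, div_le_iff₀ hε] at h4
    refine le_of_mul_le_mul_left ?_ hC0
    linarith
  have hcard : ((S ∩ Set.Icc 1 N).ncard : ℝ) ≤ (n₀ + 2) + (√(N : ℝ) + 1) + ε / 2 * N := by
    have h1 := Set.ncard_le_ncard hsub (Finset.finite_toSet _)
    rw [Set.ncard_coe_finset] at h1
    have h2 := (Finset.card_union_le (Finset.range (n₀ + 2) ∪ Finset.range (N.sqrt + 1)) E).trans
      (Nat.add_le_add_right (Finset.card_union_le _ _) _)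
    rw [Finset.card_range, Finset.card_range] at h2
    have h3 : ((S ∩ Set.Icc 1 N).ncard : ℝ) ≤ (n₀ + 2 : ℕ) + (N.sqrt + 1 : ℕ) + E.card := by
      exact_mod_cast h1.trans h2
    have h4 := Real.nat_sqrt_le_real_sqrt (a := N)
    push_cast at h3
    linarith
  have hsmall : (n₀ + 2) + (√(N : ℝ) + 1) < ε / 2 * N := by
    rw [div_lt_iff₀ hε] at hN1
    have hsq := Real.sq_sqrt hN0.le
    have hn₀' : (0 : ℝ) ≤ n₀ := Nat.cast_nonneg _
    nlinarith
  rw [Real.dist_eq, sub_zero, abs_of_nonneg (by positivity), div_lt_iff₀ hN0]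
  linarith
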